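/- Let $\mathcal{E}$ be a locally presentable and locally cartesian closed category with a functorial cylinder $I\otimes(-)\colon\mathcal{E}\to\mathcal{E}$, endpoint inclusions $\delta^0,\delta^1\colon \mathrm{Id}\to I\otimes(-)$, contractions $\varepsilon\colon I\otimes(-)\to\mathrm{Id}$ (so $\varepsilon\delta^k=\mathrm{id}$) and connections $c^k\colon I\otimes I\otimes(-)\to I\otimes(-)$ (so that, for $k\in\{0,1\}$, $c^k\circ(\delta^k\otimes I\otimes(-))=\delta^k\circ\varepsilon=c^k\circ(I\otimes\delta^k)$ and $c^k\circ(\delta^{1-k}\otimes I\otimes(-))=\mathrm{id}=c^k\circ(I\otimes\delta^{1-k})$), and suppose that $I\otimes(-)$ has a right adjoint. For $i\colon A\to B$ write $\delta^k\mathbin{\hat\otimes}i\colon (I\otimes A)+_A B\to I\otimes B$ for the Leibniz product; it defines an endofunctor of the arrow category $\mathcal{E}^\to$. *Conventions.* For a functor $u\colon\mathcal{J}\to\mathcal{E}^\to$, a right $\mathcal{J}$-map is an arrow $f$ with a choice of diagonal filler for every $j\in\mathcal{J}$ and every commutative square $u_j\to f$, natural in $j$; with the squares that respect the chosen fillers,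 right $\mathcal{J}$-maps form a category $\mathcal{J}^{\pitchfork}$ over $\mathcal{E}^\to$. Left $\mathcal{J}$-maps and their category ${}^{\pitchfork}\mathcal{J}$ are defined dually. An algebraic weak factorization system (awfs) $(\mathsf{L},\mathsf{R})$ on $\mathcal{E}$ is a functorial factorization $f=\mathsf{R}f\circ\mathsf{L}f$ with a comonad structure on $\mathsf{L}$ and a monad structure on $\mathsf{R}$, extending the canonical copointing and pointing, such that the canonical transformation $\mathsf{L}\mathsf{R}\to\mathsf{R}\mathsf{L}$ is a distributive law. It is algebraically-free on $u$ if its category of $\mathsf{R}$-monad algebras is isomorphic to $\mathcal{J}^{\pitchfork}$ over $\mathcal{E}^\to$, and cofibrantly generated if it is algebraically-free on some $u$ with $\mathcal{J}$ small. An awfs $(\mathsf{C},\mathsf{F_t})$ is suitable if it is cofibrantly generated and, writing $\mathsf{Cof}$ for the category of coalgebras of the copointed endofunctor $\mathsf{C}$, the following functors lift along the forgetful functor $\mathsf{Cof}\to\mathcal{E}^\to$: the functor $\mathcal{E}\to\mathcal{E}^\to$, $X\mapsto(0\to X)$, to a functor $\mathcal{E}\to\mathsf{Cof}$; the functor $(g,h)\mapsto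 h^*(g)$ on cospans, to a functor $\mathsf{Cof}\times_{\mathcal{E}}\mathcal{E}^\to\to\mathsf{Cof}$; and $\delta^k\mathbin{\hat\otimes}(-)$, to a functor $\mathsf{Cof}\to\mathsf{Cof}$, for $k\in\{0,1\}$. **Theorem.** Let $(\mathsf{C},\mathsf{F_t})$ be a suitable awfs on $\mathcal{E}$, algebraically-free on $u\colon\mathcal{I}\to\mathcal{E}^\to$ with $\mathcal{I}$ small. Let $u_\otimes\colon\mathcal{I}_\otimes=\mathcal{I}+\mathcal{I}\to\mathcal{E}^\to$ be given on the two summands by $\delta^0\mathbin{\hat\otimes}u$ and $\delta^1\mathbin{\hat\otimes}u$. Let $\mathsf{Fib}=(\mathcal{I}_\otimes)^{\pitchfork}$ be the category of uniform fibrations and $\mathsf{TrivCof}={}^{\pitchfork}\mathsf{Fib}$ the category of uniform trivial cofibrations. Then $\mathcal{E}$ admits a cofibrantly generated awfs $(\mathsf{C_t},\mathsf{F})$ such that, as categories over $\mathcal{E}^\to$, $\mathsf{TrivCof}$ is isomorphic to the category of coalgebras of the copointed endofunctor $\mathsf{C_t}$, and $\mathsf{Fib}$ is isomorphic to the category of monad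 algebras of $\mathsf{F}$. -/

import Mathlib

open CategoryTheory CategoryTheory.Limits

universe w v u v₁ u₁ v₂ u₂

namespace UniformFibrations

/-! ### Standing assumptions on the ambient category -/

/-- A category is locally cartesian closed if it has finite limits and every pullback functor
`f^* : E/Y ⥤ E/X` has a right adjoint (pushforward along `f`). -/
class LocallyCartesianClosed (E : Type u) [Category.{v} E] : Prop where
  hasFiniteLimits : HasFiniteLimits E
  pullback_isLeftAdjoint :
    ∀ {X Y : E} (f : X ⟶ Y), (Over.pullback f).IsLeftAdjoint

attribute [instance] LocallyCartesianClosed.hasFiniteLimits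

/-- A locally presentable category is cocomplete. -/
instance hasColimits_of_isLocallyPresentable (E : Type u) [Category.{w} E]
    [IsLocallyPresentable.{w} E] : HasColimits E := by
  obtain ⟨κ, _, _⟩ := IsLocallyPresentable.exists_cardinal.{w} E
  infer_instance

/-! ### Categories over a fixed base -/

/-- `U : C ⥤ X` and `V : D ⥤ X` are isomorphic as categories over `X`: there is an isomorphism of
categories between `C` and `D` that commutes strictly with the functors to `X`. -/
def IsoOver {C : Type u₁} [Category.{v₁} C] {D : Type u₂} [Category.{v₂} D]
    {X : Type u} [Category.{v} X] (U : C ⥤ X) (V : D ⥤ X) : Prop :=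
  ∃ (F : C ⥤ D) (G : D ⥤ C), F ⋙ G = 𝟭 C ∧ G ⋙ F = 𝟭 D ∧ F ⋙ V = U

/-! ### Algebraic orthogonality -/

section Orthogonality

variable {E : Type u} [Category.{v} E] {J : Type u₁} [Category.{v₁} J]

/-- A right `J`-map, for `U : J ⥤ Arrow E`: an arrow `f` with a function which assigns to each
`j : J` and each commuting square from `U j` to `f` a diagonal filler, naturally in `j`. -/
structure RightMap (U : J ⥤ Arrow E) where
  arrow : Arrow E
  lift : ∀ (j : J), (U.obj j ⟶ arrow) → ((U.obj j).right ⟶ arrow.left)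
  fac_left : ∀ (j : J) (sq : U.obj j ⟶ arrow), (U.obj j).hom ≫ lift j sq = sq.left
  fac_right : ∀ (j : J) (sq : U.obj j ⟶ arrow), lift j sq ≫ arrow.hom = sq.right
  natural : ∀ {i j : J} (σ : i ⟶ j) (sq : U.obj j ⟶ arrow),
    (U.map σ).right ≫ lift j sq = lift i (U.map σ ≫ sq)

/-- A morphism of right `J`-maps: a square that respects the chosen fillers. -/
@[ext]
structure RightMap.Hom {U : J ⥤ Arrow E} (p q : RightMap U) where
  sq : p.arrow ⟶ q.arrow
  comm : ∀ (j : J) (s : U.obj j ⟶ p.arrow), p.lift j s ≫ sq.left = q.lift j (s ≫ sq)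

instance (U : J ⥤ Arrow E) : Category (RightMap U) where
  Hom p q := RightMap.Hom p q
  id p := ⟨𝟙 _, by intros; simp⟩
  comp {p q r} α β := ⟨α.sq ≫ β.sq, fun j s => by
    rw [Arrow.comp_left, ← Category.assoc, α.comm, β.comm, Category.assoc]⟩
  id_comp _ := RightMap.Hom.ext (Category.id_comp _)
  comp_id _ := RightMap.Hom.ext (Category.comp_id _)
  assoc _ _ _ := RightMap.Hom.ext (Category.assoc _ _ _)

/-- The right orthogonal of `U`: the forgetful functor from right `J`-maps to arrows. -/
def RightMap.forget (U : J ⥤ Arrow E) : RightMap U ⥤ Arrow E where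
  obj p := p.arrow
  map α := α.sq

/-- A left `J`-map, for `U : J ⥤ Arrow E`: an arrow `f` with a function which assigns to each
`j : J` and each commuting square from `f` to `U j` a diagonal filler, naturally in `j`. -/
structure LeftMap (U : J ⥤ Arrow E) where
  arrow : Arrow E
  lift : ∀ (j : J), (arrow ⟶ U.obj j) → (arrow.right ⟶ (U.obj j).left)
  fac_left : ∀ (j : J) (sq : arrow ⟶ U.obj j), arrow.hom ≫ lift j sq = sq.left
  fac_right : ∀ (j : J) (sq : arrow ⟶ U.obj j), lift j sq ≫ (U.obj j).hom = sq.right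
  natural : ∀ {i j : J} (σ : i ⟶ j) (sq : arrow ⟶ U.obj i),
    lift i sq ≫ (U.map σ).left = lift j (sq ≫ U.map σ)

/-- A morphism of left `J`-maps: a square that respects the chosen fillers. -/
@[ext]
structure LeftMap.Hom {U : J ⥤ Arrow E} (p q : LeftMap U) where
  sq : p.arrow ⟶ q.arrow
  comm : ∀ (j : J) (s : q.arrow ⟶ U.obj j), sq.right ≫ q.lift j s = p.lift j (sq ≫ s)

instance (U : J ⥤ Arrow E) : Category (LeftMap U) where
  Hom p q := LeftMap.Hom p q
  id p := ⟨𝟙 _, by intros; simp⟩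
  comp {p q r} α β := ⟨α.sq ≫ β.sq, fun j s => by
    rw [Arrow.comp_right, Category.assoc, β.comm, α.comm, Category.assoc]⟩
  id_comp _ := LeftMap.Hom.ext (Category.id_comp _)
  comp_id _ := LeftMap.Hom.ext (Category.comp_id _)
  assoc _ _ _ := LeftMap.Hom.ext (Category.assoc _ _ _)

/-- The left orthogonal of `U`: the forgetful functor from left `J`-maps to arrows. -/
def LeftMap.forget (U : J ⥤ Arrow E) : LeftMap U ⥤ Arrow E where
  obj p := p.arrow
  map α := α.sq

end Orthogonality

/-! ### Coalgebras for a copointed endofunctor -/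

section Copointed

variable {C : Type u} [Category.{v} C]

/-- A coalgebra for the copointed endofunctor `(G, ε)`: a section of `ε` at an object. -/
structure CopointedCoalgebra (G : C ⥤ C) (ε : G ⟶ 𝟭 C) where
  V : C
  str : V ⟶ G.obj V
  counit : str ≫ ε.app V = 𝟙 V

/-- A morphism of coalgebras for a copointed endofunctor. -/
@[ext]
structure CopointedCoalgebra.Hom {G : C ⥤ C} {ε : G ⟶ 𝟭 C} (p q : CopointedCoalgebra G ε) where
  f : p.V ⟶ q.V
  comm : p.str ≫ G.map f = f ≫ q.str

instance (G : C ⥤ C) (ε : G ⟶ 𝟭 C) : Category (CopointedCoalgebra G ε) where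
  Hom p q := CopointedCoalgebra.Hom p q
  id p := ⟨𝟙 _, by simp⟩
  comp {p q r} α β := ⟨α.f ≫ β.f, by
    rw [G.map_comp, ← Category.assoc, α.comm, Category.assoc, β.comm, Category.assoc]⟩
  id_comp _ := CopointedCoalgebra.Hom.ext (Category.id_comp _)
  comp_id _ := CopointedCoalgebra.Hom.ext (Category.comp_id _)
  assoc _ _ _ := CopointedCoalgebra.Hom.ext (Category.assoc _ _ _)

/-- The forgetful functor from coalgebras of a copointed endofunctor. -/
def CopointedCoalgebra.forget (G : C ⥤ C) (ε : G ⟶ 𝟭 C) : CopointedCoalgebra G ε ⥤ C where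
  obj p := p.V
  map α := α.f

end Copointed

/-! ### Functorial factorizations and algebraic weak factorization systems -/

section Factorization

variable (E : Type u) [Category.{v} E]

/-- A functorial factorization: Mathlib's notion, with no condition on the two classes of maps. -/
abbrev FunctorialFactorization :=
  MorphismProperty.FunctorialFactorizationData (⊤ : MorphismProperty E) (⊤ : MorphismProperty E)

end Factorization

namespace FunctorialFactorization

variable {E : Type u} [Category.{v} E] (F : FunctorialFactorization E)

/-- The endofunctor `L` of the arrow category, sending `f` to the first factor of `f`. -/
def L : Arrow E ⥤ Arrow E where
  obj f := Arrow.mk (F.i.app f)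
  map φ := Arrow.homMk φ.left (F.Z.map φ) (F.i.naturality φ)
  map_id f := by
    ext
    · rfl
    · exact F.Z.map_id f
  map_comp φ ψ := by
    ext
    · rfl
    · exact F.Z.map_comp φ ψ

/-- The endofunctor `R` of the arrow category, sending `f` to the second factor of `f`. -/
def R : Arrow E ⥤ Arrow E where
  obj f := Arrow.mk (F.p.app f)
  map φ := Arrow.homMk (F.Z.map φ) φ.right (F.p.naturality φ)
  map_id f := by
    ext
    · exact F.Z.map_id f
    · rfl
  map_comp φ ψ := by
    ext
    · exact F.Z.map_comp φ ψ
    · rfl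

/-- The canonical copointing `(Id, R f) : L f ⟶ f`. -/
def ε : F.L ⟶ 𝟭 (Arrow E) where
  app f := Arrow.homMk (𝟙 f.left) (F.p.app f)
    ((Category.id_comp _).trans (F.fac_app (f := f)).symm)
  naturality f g φ := by
    ext
    · exact (Category.comp_id _).trans (Category.id_comp _).symm
    · exact F.p.naturality φ

/-- The canonical pointing `(L f, Id) : f ⟶ R f`. -/
def η : 𝟭 (Arrow E) ⟶ F.R where
  app f := Arrow.homMk (F.i.app f) (𝟙 f.right)
    ((F.fac_app (f := f)).trans (Category.comp_id _).symm)
  naturality f g φ := by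
    ext
    · exact F.i.naturality φ
    · exact (Category.comp_id _).trans (Category.id_comp _).symm

end FunctorialFactorization

/-- A functorial factorization together with a comultiplication making `L` a comonad and a
multiplication making `R` a monad (for the canonical copointing and pointing). -/
structure ComonadMonadFactorization (E : Type u) [Category.{v} E] where
  fact : FunctorialFactorization E
  δ : fact.L ⟶ fact.L ⋙ fact.L
  coassoc : ∀ f : Arrow E, δ.app f ≫ fact.L.map (δ.app f) = δ.app f ≫ δ.app (fact.L.obj f)
  left_counit : ∀ f : Arrow E, δ.app f ≫ fact.ε.app (fact.L.obj f) = 𝟙 (fact.L.obj f)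
  right_counit : ∀ f : Arrow E, δ.app f ≫ fact.L.map (fact.ε.app f) = 𝟙 (fact.L.obj f)
  μ : fact.R ⋙ fact.R ⟶ fact.R
  assoc : ∀ f : Arrow E, fact.R.map (μ.app f) ≫ μ.app f = μ.app (fact.R.obj f) ≫ μ.app f
  left_unit : ∀ f : Arrow E, fact.η.app (fact.R.obj f) ≫ μ.app f = 𝟙 (fact.R.obj f)
  right_unit : ∀ f : Arrow E, fact.R.map (fact.η.app f) ≫ μ.app f = 𝟙 (fact.R.obj f)

namespace ComonadMonadFactorization

variable {E : Type u} [Category.{v} E] (A : ComonadMonadFactorization E)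

/-- The comonad on the arrow category with underlying endofunctor `L`. -/
def comonad : Comonad (Arrow E) where
  toFunctor := A.fact.L
  ε := A.fact.ε
  δ := A.δ
  coassoc := A.coassoc
  left_counit := A.left_counit
  right_counit := A.right_counit

/-- The monad on the arrow category with underlying endofunctor `R`. -/
def monad : Monad (Arrow E) where
  toFunctor := A.fact.R
  η := A.fact.η
  μ := A.μ
  assoc := A.assoc
  left_unit := A.left_unit
  right_unit := A.right_unit

/-- The canonical natural transformation `L R ⟶ R L`. At `f : X ⟶ Y`, factored through `M f`, it is
the square from `L (R f) : M f ⟶ M (R f)` to `R (L f) : M (L f) ⟶ M f` whose horizontal sides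
are the components of the comultiplication and of the multiplication at `f`. -/
def distrib : A.fact.R ⋙ A.fact.L ⟶ A.fact.L ⋙ A.fact.R where
  app f := Arrow.homMk (f := (A.fact.R ⋙ A.fact.L).obj f) (g := (A.fact.L ⋙ A.fact.R).obj f)
    ((A.δ.app f).right) ((A.μ.app f).left)
    ((congrArg CommaMorphism.right (A.left_counit f)).trans
      (congrArg CommaMorphism.left (A.left_unit f)).symm)
  naturality f g φ := by
    ext
    · exact congrArg CommaMorphism.right (A.δ.naturality φ)
    · exact congrArg CommaMorphism.left (A.μ.naturality φ)

end ComonadMonadFactorization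

/-- An algebraic weak factorization system on `E`: a functorial factorization with a comonad
structure on `L` and a monad structure on `R` such that the canonical transformation `L R ⟶ R L`
is a distributive law of the comonad over the monad. -/
structure AWFS (E : Type u) [Category.{v} E] extends ComonadMonadFactorization E where
  distrib_unit : ∀ f : Arrow E,
    fact.L.map (fact.η.app f) ≫ toComonadMonadFactorization.distrib.app f =
      fact.η.app (fact.L.obj f)
  distrib_counit : ∀ f : Arrow E,
    toComonadMonadFactorization.distrib.app f ≫ fact.R.map (fact.ε.app f) =
      fact.ε.app (fact.R.obj f)
  distrib_mul : ∀ f : Arrow E,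
    fact.L.map (μ.app f) ≫ toComonadMonadFactorization.distrib.app f =
      toComonadMonadFactorization.distrib.app (fact.R.obj f) ≫
        fact.R.map (toComonadMonadFactorization.distrib.app f) ≫ μ.app (fact.L.obj f)
  distrib_comul : ∀ f : Arrow E,
    toComonadMonadFactorization.distrib.app f ≫ fact.R.map (δ.app f) =
      δ.app (fact.R.obj f) ≫ fact.L.map (toComonadMonadFactorization.distrib.app f) ≫
        toComonadMonadFactorization.distrib.app (fact.L.obj f)

namespace AWFS

variable {E : Type u} [Category.{v} E] (A : AWFS E)

/-- The category of monad algebras for `R`. -/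
abbrev RAlg := A.monad.Algebra

/-- The forgetful functor from monad algebras for `R` to arrows. -/
abbrev forgetRAlg : A.RAlg ⥤ Arrow E := A.monad.forget

/-- The category of coalgebras for `L`, regarded as a copointed endofunctor. -/
abbrev LCoalg := CopointedCoalgebra A.fact.L A.fact.ε

/-- The forgetful functor from copointed endofunctor coalgebras for `L` to arrows. -/
abbrev forgetLCoalg : A.LCoalg ⥤ Arrow E := CopointedCoalgebra.forget A.fact.L A.fact.ε

/-- `A` is algebraically-free on `U : J ⥤ Arrow E` if its monad algebras are, as a category over
the arrow category, the right `J`-maps. -/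
def IsAlgebraicallyFree {J : Type u₁} [Category.{v₁} J] (U : J ⥤ Arrow E) : Prop :=
  IsoOver A.forgetRAlg (RightMap.forget U)

/-- `A` is cofibrantly generated if it is algebraically-free on some small category of arrows. -/
def IsCofibrantlyGenerated : Prop :=
  ∃ (J : Type w) (_ : SmallCategory J) (U : J ⥤ Arrow E), A.IsAlgebraicallyFree U

end AWFS

/-! ### Functorial cylinders -/

/-- A functorial cylinder `I ⊗ (-)` on `E` with contractions and connections. -/
structure Cylinder (E : Type u) [Category.{v} E] where
  /-- the functor `I ⊗ (-)` -/
  I : E ⥤ E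
  /-- the endpoint inclusions -/
  δ : Fin 2 → (𝟭 E ⟶ I)
  /-- the contraction -/
  ε : I ⟶ 𝟭 E
  /-- the connections -/
  c : Fin 2 → (I ⋙ I ⟶ I)
  δ_ε : ∀ (k : Fin 2) (X : E), (δ k).app X ≫ ε.app X = 𝟙 X
  δ_I_c : ∀ (k : Fin 2) (X : E),
    (δ k).app (I.obj X) ≫ (c k).app X = ε.app X ≫ (δ k).app X
  I_δ_c : ∀ (k : Fin 2) (X : E),
    I.map ((δ k).app X) ≫ (c k).app X = ε.app X ≫ (δ k).app X
  δ_I_c' : ∀ (k : Fin 2) (X : E),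
    (δ (1 - k)).app (I.obj X) ≫ (c k).app X = 𝟙 (I.obj X)
  I_δ_c' : ∀ (k : Fin 2) (X : E),
    I.map ((δ (1 - k)).app X) ≫ (c k).app X = 𝟙 (I.obj X)

namespace Cylinder

variable {E : Type u} [Category.{v} E] [HasPushouts E] (T : Cylinder E)

/-- The Leibniz product with the endpoint inclusion `δ k`, as an endofunctor of the arrow category:
it sends `i : A ⟶ B` to the map `(I ⊗ A) +_A B ⟶ I ⊗ B`. It is the Leibniz construction for the
evaluation bifunctor `(E ⥤ E) × E ⥤ E`, at the natural transformation `δ k`. -/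
noncomputable def leibniz (k : Fin 2) : Arrow E ⥤ Arrow E :=
  (Functor.leibnizPushout (𝟭 (E ⥤ E))).obj (Arrow.mk (T.δ k))

/-- For `U : J ⥤ Arrow E`, the functor on `J + J` given on the two summands by the Leibniz
products of `U` with the two endpoint inclusions. -/
noncomputable def tensor {J : Type u₁} [Category.{v₁} J] (U : J ⥤ Arrow E) : J ⊕ J ⥤ Arrow E :=
  Functor.sum' (U ⋙ T.leibniz 0) (U ⋙ T.leibniz 1)

/-- The category of uniform fibrations: right maps for the generating uniform trivial
cofibrations. -/
abbrev Fib {J : Type u₁} [Category.{v₁} J] (U : J ⥤ Arrow E) := RightMap (T.tensor U)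

/-- The forgetful functor from uniform fibrations to arrows. -/
noncomputable abbrev forgetFib {J : Type u₁} [Category.{v₁} J] (U : J ⥤ Arrow E) :
    T.Fib U ⥤ Arrow E :=
  RightMap.forget (T.tensor U)

/-- The category of uniform trivial cofibrations: left maps for the category of uniform
fibrations. -/
abbrev TrivCof {J : Type u₁} [Category.{v₁} J] (U : J ⥤ Arrow E) := LeftMap (T.forgetFib U)

/-- The forgetful functor from uniform trivial cofibrations to arrows. -/
noncomputable abbrev forgetTrivCof {J : Type u₁} [Category.{v₁} J] (U : J ⥤ Arrow E) :
    T.TrivCof U ⥤ Arrow E :=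
  LeftMap.forget (T.forgetFib U)

end Cylinder

/-! ### Suitable algebraic weak factorization systems -/

section Suitable

variable {E : Type u} [Category.{v} E]

/-- The functor sending an object `X` to the arrow `0 ⟶ X`. -/
noncomputable def bot [HasInitial E] : E ⥤ Arrow E where
  obj X := Arrow.mk (initial.to X)
  map f := Arrow.homMk (𝟙 _) f (initial.hom_ext _ _)
  map_id X := by ext <;> simp
  map_comp f g := by ext <;> simp

/-- The category of cospans `(g, h)` with `g` an object of `J` (an arrow `U g : A ⟶ X`) and
`h : Y ⟶ X`, that is the pullback of `cod ∘ U : J ⥤ E` and `cod : Arrow E ⥤ E`, presented as a comma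
category so that no equation between objects is needed. -/
abbrev Cospans {J : Type u₁} [Category.{v₁} J] (U : J ⥤ Arrow E) :=
  Comma (𝟭 E) (U ⋙ Arrow.rightFunc)

/-- The functor sending a cospan `(g, h)` to the pullback `h^* g` of `g` along `h`. -/
noncomputable def pullbackFunctor [HasPullbacks E] {J : Type u₁} [Category.{v₁} J]
    (U : J ⥤ Arrow E) : Cospans U ⥤ Arrow E where
  obj X := Arrow.mk (pullback.snd (U.obj X.right).hom X.hom)
  map {X Y} φ := Arrow.homMk
    (pullback.map (U.obj X.right).hom X.hom (U.obj Y.right).hom Y.hom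
      (U.map φ.right).left φ.left (U.map φ.right).right
      (Arrow.w (U.map φ.right)).symm φ.w.symm)
    φ.left (pullback.lift_snd _ _ _)
  map_id X := by
    ext
    · apply pullback.hom_ext
      · refine (pullback.lift_fst _ _ _).trans ?_
        simp
      · refine (pullback.lift_snd _ _ _).trans ?_
        simp
    · rfl
  map_comp {X Y Z} φ ψ := by
    ext
    · apply pullback.hom_ext
      · refine (pullback.lift_fst _ _ _).trans (Eq.trans ?_
          (((Category.assoc _ _ _).trans (congrArg _ (pullback.lift_fst _ _ _))).trans
            (((Category.assoc _ _ _).symm.trans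
              (congrArg (· ≫ _) (pullback.lift_fst _ _ _))))).symm)
        simp
      · refine (pullback.lift_snd _ _ _).trans (Eq.trans ?_
          (((Category.assoc _ _ _).trans (congrArg _ (pullback.lift_snd _ _ _))).trans
            (((Category.assoc _ _ _).symm.trans
              (congrArg (· ≫ _) (pullback.lift_snd _ _ _))))).symm)
        simp
    · rfl

/-- An awfs is suitable, with respect to a functorial cylinder, if it is cofibrantly generated and
its category of uniform cofibrations (the copointed endofunctor coalgebras for `L`) contains all
maps `0 ⟶ X`, is closed under pullback and is closed under Leibniz product with the endpoint
inclusions, each time functorially. -/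
structure AWFS.IsSuitable [HasInitial E] [HasPullbacks E] [HasPushouts E] (A : AWFS E)
    (T : Cylinder E) : Prop where
  cofibrantlyGenerated : AWFS.IsCofibrantlyGenerated.{v} A
  bot_lift : ∃ B : E ⥤ A.LCoalg, B ⋙ A.forgetLCoalg = bot
  pullback_lift : ∃ P : Cospans A.forgetLCoalg ⥤ A.LCoalg,
    P ⋙ A.forgetLCoalg = pullbackFunctor A.forgetLCoalg
  leibniz_lift : ∀ k : Fin 2, ∃ D : A.LCoalg ⥤ A.LCoalg,
    D ⋙ A.forgetLCoalg = A.forgetLCoalg ⋙ T.leibniz k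

end Suitable

end UniformFibrations

/-! Write `V : K ⥤ Arrow E` for a functor from a small category, with `E` locally presentable; here
`V = T.tensor U` and `K = J ⊕ J`. Everything follows once each arrow `f` has a free right `K`-map
with the codomain of `f`, that is, a factorization `f = i ≫ p` with `p` universal among right maps
under `f`.

Existence of free right maps (`nonempty_freeRightMap`) is an orthogonal reflection. A diagonal
filler determines the square that it fills, so a right map on `g` is a presheaf over the presheaf of
maps `cod (V j) ⟶ dom g` whose elements correspond bijectively to squares `V j ⟶ g`. Dropping
bijectivity gives a cocomplete comma category. Bijectivity is orthogonality to a small family of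
maps between presentable objects (`isLocal_iff_isTotal`), so the orthogonal objects are reflective.
A universal arrow found this way is then normalized to be the identity on codomains
(`nonempty_of_universal`).

Free right maps form an awfs (`awfs`): the monad is that of the free construction, and the
comultiplication comes from the fact that right maps compose vertically, so that `R (L f)` followed
by `R f` is again a right map under `f`. Each law compares two morphisms out of a free right map,
hence only has to be tested on the unit. Monad algebras are right maps because the free-forgetful
adjunction is monadic on the nose (`awfs_isAlgebraicallyFree`). A left map is determined by its
filler against its own free right map, by a Yoneda argument, and that filler is exactly a copointed
coalgebra structure (`leftMap_isoOver_coalg`). -/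

namespace UniformFibrations

section

/-! ### Isomorphisms of categories over a base -/

section IsoOver

variable {C : Type u₁} [Category.{v₁} C] {D : Type u₂} [Category.{v₂} D]
  {X : Type u} [Category.{v} X]

lemma IsoOver.symm {U : C ⥤ X} {V : D ⥤ X} (h : IsoOver U V) : IsoOver V U := by
  obtain ⟨F, G, hFG, hGF, rfl⟩ := h
  exact ⟨G, F, hGF, hFG, by rw [← Functor.assoc, hGF, Functor.id_comp]⟩

/-- Functors into a category that is faithful over `X` agree if they agree on objects and over
`X`. -/
lemma functor_eq_of_comp_faithful {H K : C ⥤ D} (V : D ⥤ X) [V.Faithful]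
    (hobj : ∀ c, H.obj c = K.obj c) (hV : H ⋙ V = K ⋙ V) : H = K := by
  refine CategoryTheory.Functor.ext hobj fun c d f => V.map_injective ?_
  simpa [eqToHom_map] using Functor.congr_hom hV f

/-- Faithfulness makes morphisms automatic: functors over `X` that are inverse to each other on
objects are inverse functors. -/
lemma IsoOver.of_faithful {U : C ⥤ X} {V : D ⥤ X} [U.Faithful] [V.Faithful]
    (F : C ⥤ D) (G : D ⥤ C) (hF : F ⋙ V = U) (hG : G ⋙ U = V)
    (hFG : ∀ c, G.obj (F.obj c) = c) (hGF : ∀ d, F.obj (G.obj d) = d) : IsoOver U V :=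
  ⟨F, G, functor_eq_of_comp_faithful U hFG (by rw [Functor.assoc, hG, hF, Functor.id_comp]),
    functor_eq_of_comp_faithful V hGF (by rw [Functor.assoc, hF, hG, Functor.id_comp]), hF⟩

end IsoOver

variable {E : Type u} [Category.{v} E] {J : Type u₁} [Category.{v₁} J]

instance (U : J ⥤ Arrow E) : (RightMap.forget U).Faithful where
  map_injective h := RightMap.Hom.ext h

instance (U : J ⥤ Arrow E) : (LeftMap.forget U).Faithful where
  map_injective h := LeftMap.Hom.ext h

instance {C : Type u} [Category.{v} C] (G : C ⥤ C) (ε : G ⟶ 𝟭 C) :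
    (CopointedCoalgebra.forget G ε).Faithful where
  map_injective h := CopointedCoalgebra.Hom.ext h

/-! ### Structures of right map on a given arrow -/

/-- A structure of right `J`-map on the arrow `g`. -/
structure RightStr (U : J ⥤ Arrow E) (g : Arrow E) where
  lift : ∀ (j : J), (U.obj j ⟶ g) → ((U.obj j).right ⟶ g.left)
  fac_left : ∀ (j : J) (sq : U.obj j ⟶ g), (U.obj j).hom ≫ lift j sq = sq.left
  fac_right : ∀ (j : J) (sq : U.obj j ⟶ g), lift j sq ≫ g.hom = sq.right
  natural : ∀ {i j : J} (σ : i ⟶ j) (sq : U.obj j ⟶ g),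
    (U.map σ).right ≫ lift j sq = lift i (U.map σ ≫ sq)

/-- The right map with a given underlying arrow and structure. -/
@[reducible]
def RightStr.rightMap {U : J ⥤ Arrow E} {g : Arrow E} (s : RightStr U g) : RightMap U where
  arrow := g
  lift := s.lift
  fac_left := s.fac_left
  fac_right := s.fac_right
  natural := s.natural

/-- The structure of a right map on its underlying arrow. -/
@[reducible]
def RightMap.str {U : J ⥤ Arrow E} (p : RightMap U) : RightStr U p.arrow where
  lift := p.lift
  fac_left := p.fac_left
  fac_right := p.fac_right
  natural := p.natural

namespace RightStr

variable {U : J ⥤ Arrow E}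

/-- A square respects the given structures of right map. -/
def IsHom {g h : Arrow E} (s : RightStr U g) (t : RightStr U h) (φ : g ⟶ h) : Prop :=
  ∀ (j : J) (sq : U.obj j ⟶ g), s.lift j sq ≫ φ.left = t.lift j (sq ≫ φ)

lemma IsHom.comp {g h k : Arrow E} {s : RightStr U g} {t : RightStr U h} {r : RightStr U k}
    {φ : g ⟶ h} {ψ : h ⟶ k} (hφ : s.IsHom t φ) (hψ : t.IsHom r ψ) : s.IsHom r (φ ≫ ψ) := by
  intro j sq
  rw [Arrow.comp_left, ← Category.assoc, hφ, hψ, Category.assoc]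

lemma isHom_id {g : Arrow E} (s : RightStr U g) : s.IsHom s (𝟙 g) := by
  intro j sq
  simp

/-- The morphism of right maps given by a square that respects the structures. -/
@[reducible]
def IsHom.hom {g h : Arrow E} {s : RightStr U g} {t : RightStr U h} {φ : g ⟶ h}
    (hφ : s.IsHom t φ) : s.rightMap ⟶ t.rightMap :=
  RightMap.Hom.mk φ hφ

/-- Vertical composition of right maps. -/
def comp {X Y Z : E} {a : X ⟶ Y} {b : Y ⟶ Z} (s : RightStr U (Arrow.mk a))
    (t : RightStr U (Arrow.mk b)) : RightStr U (Arrow.mk (a ≫ b)) where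
  lift j sq := s.lift j (Arrow.homMk sq.left
    (t.lift j (Arrow.homMk (sq.left ≫ a) sq.right (by simp)))
    (by rw [t.fac_left]; rfl))
  fac_left j sq := s.fac_left _ _
  fac_right j sq := (Category.assoc _ _ _).symm.trans
    ((congrArg (· ≫ b) (s.fac_right j _)).trans (t.fac_right j _))
  natural σ sq := by
    rw [s.natural]
    congr 1
    ext
    · rfl
    · refine (t.natural _ _).trans ?_
      congr 1
      ext
      · simp
      · rfl

section

variable {X Y Z X' Y' Z' : E} {a : X ⟶ Y} {b : Y ⟶ Z} {a' : X' ⟶ Y'} {b' : Y' ⟶ Z'}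
  {s : RightStr U (Arrow.mk a)} {t : RightStr U (Arrow.mk b)}
  {s' : RightStr U (Arrow.mk a')} {t' : RightStr U (Arrow.mk b')}

lemma comp_lift_comp (s : RightStr U (Arrow.mk a)) (t : RightStr U (Arrow.mk b)) (j : J)
    (sq : U.obj j ⟶ Arrow.mk (a ≫ b)) :
    (s.comp t).lift j sq ≫ a =
      t.lift j (Arrow.homMk (sq.left ≫ a) sq.right (by simp)) :=
  s.fac_right _ _

/-- Vertical composition of morphisms of right maps. -/
lemma IsHom.vcomp {x : X ⟶ X'} {y : Y ⟶ Y'} {z : Z ⟶ Z'} {h₁ : x ≫ a' = a ≫ y}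
    {h₂ : y ≫ b' = b ≫ z}
    (hs : s.IsHom s' (Arrow.homMk (f := Arrow.mk a) (g := Arrow.mk a') x y h₁))
    (ht : t.IsHom t' (Arrow.homMk (f := Arrow.mk b) (g := Arrow.mk b') y z h₂)) :
    (s.comp t).IsHom (s'.comp t')
      (Arrow.homMk (f := Arrow.mk (a ≫ b)) (g := Arrow.mk (a' ≫ b')) x z
        (by dsimp; rw [reassoc_of% h₁, h₂, Category.assoc])) := by
  intro j sq
  refine (hs j _).trans ?_
  refine congrArg (s'.lift j) ?_
  ext
  · rfl
  · refine (ht j _).trans (congrArg (t'.lift j) ?_)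
    ext
    · dsimp; simp [h₁]
    · rfl

/-- The square from a composite to its second factor. -/
lemma isHom_comp_snd (s : RightStr U (Arrow.mk a)) (t : RightStr U (Arrow.mk b)) :
    (s.comp t).IsHom t
      (Arrow.homMk (f := Arrow.mk (a ≫ b)) (g := Arrow.mk b) a (𝟙 Z)
        (by dsimp; rw [Category.comp_id])) := by
  intro j sq
  refine (comp_lift_comp s t j sq).trans (congrArg (t.lift j) ?_)
  ext
  · rfl
  · simp

/-- A filler for the composite is an `s`-filler of a square whose bottom side is a `t`-filler.
Pushing that bottom side along `b` gives back the original bottom side, so the choice made by `t`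
disappears. -/
lemma IsHom.comp_of_over {c : X' ⟶ Z} {r : RightStr U (Arrow.mk c)} {x : X ⟶ X'}
    {h : x ≫ c = a ≫ b}
    (hs : s.IsHom r (Arrow.homMk (f := Arrow.mk a) (g := Arrow.mk c) x b h)) :
    (s.comp t).IsHom r
      (Arrow.homMk (f := Arrow.mk (a ≫ b)) (g := Arrow.mk c) x (𝟙 Z)
        (by dsimp; rw [h, Category.comp_id])) := by
  intro j sq
  refine (hs j _).trans (congrArg (r.lift j) ?_)
  ext
  · rfl
  · exact (t.fac_right j _).trans (Category.comp_id _).symm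

/-- Both bracketings choose fillers against `c`, then `b`, then `a`, so vertical composition is
strictly associative. Coassociativity of the comultiplication rests on this. -/
lemma isHom_assoc {W : E} {c : Z ⟶ W} (s : RightStr U (Arrow.mk a)) (t : RightStr U (Arrow.mk b))
    (r : RightStr U (Arrow.mk c)) :
    ((s.comp t).comp r).IsHom (s.comp (t.comp r))
      (Arrow.homMk (f := Arrow.mk ((a ≫ b) ≫ c)) (g := Arrow.mk (a ≫ b ≫ c)) (𝟙 X) (𝟙 W)
        (by simp)) := by
  intro j sq
  refine (Category.comp_id _).trans (congrArg (s.lift j) ?_)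
  ext
  · simp
  · refine congrArg (t.lift j) ?_
    ext
    · simp
    · refine congrArg (r.lift j) ?_
      ext <;> simp

end

end RightStr

/-- A free right map on an arrow `f`, with the same codomain as `f`. -/
structure FreeRightMap (U : J ⥤ Arrow E) (f : Arrow E) where
  Z : E
  i : f.left ⟶ Z
  p : Z ⟶ f.right
  fac : i ≫ p = f.hom
  str : RightStr U (Arrow.mk p)
  desc : ∀ {g : Arrow E}, RightStr U g → (f ⟶ g) → (Z ⟶ g.left)
  desc_w : ∀ {g : Arrow E} (t : RightStr U g) (φ : f ⟶ g), desc t φ ≫ g.hom = p ≫ φ.right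
  i_desc : ∀ {g : Arrow E} (t : RightStr U g) (φ : f ⟶ g), i ≫ desc t φ = φ.left
  isHom_desc : ∀ {g : Arrow E} (t : RightStr U g) (φ : f ⟶ g),
    str.IsHom t (Arrow.homMk (f := Arrow.mk p) (desc t φ) φ.right (desc_w t φ))
  uniq : ∀ {g : Arrow E} (t : RightStr U g) {φ ψ : Arrow.mk p ⟶ g}, str.IsHom t φ →
    str.IsHom t ψ → φ.right = ψ.right → i ≫ φ.left = i ≫ ψ.left → φ.left = ψ.left

/-! ### The awfs of free right maps -/

namespace FreeRightMap

variable {U : J ⥤ Arrow E}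

lemma i_desc_assoc {f g : Arrow E} (F : FreeRightMap U f) (t : RightStr U g) (φ : f ⟶ g) {W : E}
    (k : g.left ⟶ W) : F.i ≫ F.desc t φ ≫ k = φ.left ≫ k := by
  rw [← Category.assoc, F.i_desc]

/-- The unit of a free right map. -/
def unit {f : Arrow E} (F : FreeRightMap U f) : f ⟶ Arrow.mk F.p :=
  Arrow.homMk F.i (𝟙 _) (F.fac.trans (Category.comp_id _).symm)

variable (F : ∀ f : Arrow E, FreeRightMap U f)

/-- The action of the free right map construction on squares. -/
def map {f g : Arrow E} (φ : f ⟶ g) : (F f).Z ⟶ (F g).Z :=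
  (F f).desc (F g).str (φ ≫ (F g).unit)

lemma map_p {f g : Arrow E} (φ : f ⟶ g) : map F φ ≫ (F g).p = (F f).p ≫ φ.right :=
  ((F f).desc_w _ _).trans (congrArg (_ ≫ ·) (Category.comp_id _))

lemma i_map {f g : Arrow E} (φ : f ⟶ g) : (F f).i ≫ map F φ = φ.left ≫ (F g).i :=
  (F f).i_desc _ _

lemma i_map_assoc {f g : Arrow E} (φ : f ⟶ g) {W : E} (k : (F g).Z ⟶ W) :
    (F f).i ≫ map F φ ≫ k = φ.left ≫ (F g).i ≫ k := by
  rw [← Category.assoc, i_map, Category.assoc]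

/-- The square of right maps induced by a square. -/
@[reducible]
def mapSq {f g : Arrow E} (φ : f ⟶ g) : Arrow.mk (F f).p ⟶ Arrow.mk (F g).p :=
  Arrow.homMk (map F φ) φ.right (map_p F φ)

lemma isHom_map {f g : Arrow E} (φ : f ⟶ g) : (F f).str.IsHom (F g).str (mapSq F φ) := by
  convert (F f).isHom_desc (F g).str (φ ≫ (F g).unit) using 1
  ext
  · rfl
  · exact (Category.comp_id _).symm

/-- The functorial factorization given by free right maps. -/
def factorization : FunctorialFactorization E where
  Z :=
    { obj f := (F f).Z
      map φ := map F φ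
      map_id f := (F f).uniq (F f).str (isHom_map F (𝟙 f)) (F f).str.isHom_id rfl
        (by simp [i_map])
      map_comp {f g h} φ ψ := (F f).uniq (F h).str (isHom_map F (φ ≫ ψ))
        ((isHom_map F φ).comp (isHom_map F ψ)) rfl
        (by simp [i_map, i_map_assoc]) }
  i :=
    { app f := (F f).i
      naturality _ _ φ := (i_map F φ).symm }
  p :=
    { app f := (F f).p
      naturality _ _ φ := map_p F φ }
  fac := by
    ext f
    exact (F f).fac
  hi _ := trivial
  hp _ := trivial

/-- The multiplication of the free right map monad. -/
def mul (f : Arrow E) : (F (Arrow.mk (F f).p)).Z ⟶ (F f).Z :=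
  (F (Arrow.mk (F f).p)).desc (F f).str (𝟙 _)

lemma mul_p (f : Arrow E) : mul F f ≫ (F f).p = (F (Arrow.mk (F f).p)).p :=
  ((F (Arrow.mk (F f).p)).desc_w (F f).str (𝟙 _)).trans (Category.comp_id _)

lemma i_mul (f : Arrow E) : (F (Arrow.mk (F f).p)).i ≫ mul F f = 𝟙 _ :=
  (F (Arrow.mk (F f).p)).i_desc _ _

lemma i_mul_assoc (f : Arrow E) {W : E} (k : (F f).Z ⟶ W) :
    (F (Arrow.mk (F f).p)).i ≫ mul F f ≫ k = k :=
  (Category.assoc _ _ _).symm.trans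
    ((congrArg (· ≫ k) (i_mul F f)).trans (Category.id_comp k))

/-- The multiplication as a square over the identity. -/
@[reducible]
def mulSq (f : Arrow E) : Arrow.mk (F (Arrow.mk (F f).p)).p ⟶ Arrow.mk (F f).p :=
  Arrow.homMk (mul F f) (𝟙 f.right) ((mul_p F f).trans (Category.comp_id _).symm)

lemma isHom_mul (f : Arrow E) :
    (F (Arrow.mk (F f).p)).str.IsHom (F f).str (mulSq F f) :=
  (F (Arrow.mk (F f).p)).isHom_desc (F f).str (𝟙 _)

/-- The unit of the composite of two free right maps. -/
def comulUnit (f : Arrow E) :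
    f ⟶ Arrow.mk ((F (Arrow.mk (F f).i)).p ≫ (F f).p) :=
  Arrow.homMk (F (Arrow.mk (F f).i)).i (𝟙 _) (by
    have h₁ := (F (Arrow.mk (F f).i)).fac
    have h₂ := (F f).fac
    dsimp at h₁ ⊢
    rw [reassoc_of% h₁, h₂, Category.comp_id])

/-- The comultiplication of the comonad of left factors of free right maps. -/
def comul (f : Arrow E) : (F f).Z ⟶ (F (Arrow.mk (F f).i)).Z :=
  (F f).desc ((F (Arrow.mk (F f).i)).str.comp (F f).str) (comulUnit F f)

lemma comul_p_p (f : Arrow E) :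
    comul F f ≫ (F (Arrow.mk (F f).i)).p ≫ (F f).p = (F f).p ≫ 𝟙 _ :=
  (F f).desc_w _ _

lemma i_comul (f : Arrow E) : (F f).i ≫ comul F f = (F (Arrow.mk (F f).i)).i :=
  (F f).i_desc _ _

lemma i_comul_assoc (f : Arrow E) {W : E} (k : (F (Arrow.mk (F f).i)).Z ⟶ W) :
    (F f).i ≫ comul F f ≫ k = (F (Arrow.mk (F f).i)).i ≫ k :=
  (Category.assoc _ _ _).symm.trans (congrArg (· ≫ k) (i_comul F f))

lemma isHom_comul (f : Arrow E) :
    (F f).str.IsHom ((F (Arrow.mk (F f).i)).str.comp (F f).str)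
      (Arrow.homMk (f := Arrow.mk (F f).p) (g := Arrow.mk ((F (Arrow.mk (F f).i)).p ≫ (F f).p))
        (comul F f) (𝟙 _) (comul_p_p F f)) :=
  (F f).isHom_desc _ (comulUnit F f)

/-- Projecting the composite `R (L f)`, `R f` to its second factor is a morphism of right maps, so
this is an endomorphism of a free right map that fixes the unit. -/
lemma comul_p (f : Arrow E) : comul F f ≫ (F (Arrow.mk (F f).i)).p = 𝟙 _ := by
  refine (F f).uniq (F f).str ((isHom_comul F f).comp (RightStr.isHom_comp_snd _ _))
    (F f).str.isHom_id (Category.comp_id _) ?_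
  exact (i_comul_assoc F f _).trans
    ((F (Arrow.mk (F f).i)).fac.trans (Category.comp_id _).symm)

lemma isHom_map_comp {f g : Arrow E} (φ : f ⟶ g) :
    ((F (Arrow.mk (F f).i)).str.comp (F f).str).IsHom
      ((F (Arrow.mk (F g).i)).str.comp (F g).str)
      (Arrow.homMk (f := Arrow.mk ((F (Arrow.mk (F f).i)).p ≫ (F f).p))
        (g := Arrow.mk ((F (Arrow.mk (F g).i)).p ≫ (F g).p))
        (map F ((factorization F).L.map φ)) φ.right (by
          have h₁ := map_p F ((factorization F).L.map φ)
          have h₂ := map_p F φ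
          exact (Category.assoc _ _ _).symm.trans ((congrArg (· ≫ (F g).p) h₁).trans
            ((Category.assoc _ _ _).trans
              ((congrArg (_ ≫ ·) h₂).trans (Category.assoc _ _ _).symm))))) :=
  RightStr.IsHom.vcomp (isHom_map F ((factorization F).L.map φ)) (isHom_map F φ)

lemma map_comul {f g : Arrow E} (φ : f ⟶ g) :
    map F φ ≫ comul F g = comul F f ≫ map F ((factorization F).L.map φ) := by
  refine (F f).uniq _ ((isHom_map F φ).comp (isHom_comul F g))
    ((isHom_comul F f).comp (isHom_map_comp F φ)) ?_ ?_
  · exact (Category.comp_id _).trans (Category.id_comp _).symm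
  · refine (i_map_assoc F φ _).trans ((congrArg (_ ≫ ·) (i_comul F g)).trans ?_)
    exact ((i_comul_assoc F f _).trans (i_map F ((factorization F).L.map φ))).symm

lemma map_mul {f g : Arrow E} (φ : f ⟶ g) :
    map F (mapSq F φ) ≫ mul F g = mul F f ≫ map F φ := by
  refine (F _).uniq _ ((isHom_map F (mapSq F φ)).comp (isHom_mul F g))
    ((isHom_mul F f).comp (isHom_map F φ)) ?_ ?_
  · exact (Category.comp_id _).trans (Category.id_comp _).symm
  · refine (i_map_assoc F (mapSq F φ) _).trans ((congrArg (_ ≫ ·) (i_mul F g)).trans ?_)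
    exact (Category.comp_id _).trans (i_mul_assoc F f _).symm

lemma map_unit_mul (f : Arrow E) : map F (F f).unit ≫ mul F f = 𝟙 _ := by
  refine (F _).uniq _ ((isHom_map F (F f).unit).comp (isHom_mul F f))
    (F f).str.isHom_id (Category.comp_id _) ?_
  refine (i_map_assoc F (F f).unit _).trans ((congrArg (_ ≫ ·) (i_mul F f)).trans ?_)
  rfl

lemma map_mul_mul (f : Arrow E) :
    map F (mulSq F f) ≫ mul F f = mul F (Arrow.mk (F f).p) ≫ mul F f := by
  refine (F _).uniq _ ((isHom_map F (mulSq F f)).comp (isHom_mul F f))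
    ((isHom_mul F _).comp (isHom_mul F f)) rfl ?_
  refine (i_map_assoc F (mulSq F f) _).trans ((congrArg (_ ≫ ·) (i_mul F f)).trans ?_)
  exact (Category.comp_id _).trans (i_mul_assoc F (Arrow.mk (F f).p) _).symm

/-- The counit square `L f ⟶ f` has `R f` as its bottom side, which is the situation of
`RightStr.IsHom.comp_of_over`. -/
lemma comul_map_counit (f : Arrow E) :
    comul F f ≫ map F ((factorization F).ε.app f) = 𝟙 _ := by
  refine (F f).uniq _ ((isHom_comul F f).comp
    (RightStr.IsHom.comp_of_over (isHom_map F ((factorization F).ε.app f))))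
    (F f).str.isHom_id (Category.comp_id _) ?_
  refine (i_comul_assoc F f _).trans ((i_map F ((factorization F).ε.app f)).trans ?_)
  exact (Category.id_comp _).trans (Category.comp_id _).symm

/-- The comultiplication as a square under the identity. -/
@[reducible]
def comulSq (f : Arrow E) : Arrow.mk (F f).i ⟶ Arrow.mk (F (Arrow.mk (F f).i)).i :=
  Arrow.homMk (𝟙 f.left) (comul F f) ((Category.id_comp _).trans (i_comul F f).symm)

/-- Both sides underlie morphisms from the free right map to a threefold composite. One of them
arrives with the left bracketing, which `RightStr.isHom_assoc` corrects. -/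
lemma comul_map_comul (f : Arrow E) :
    comul F f ≫ map F (comulSq F f) = comul F f ≫ comul F (Arrow.mk (F f).i) := by
  have h₁ := ((isHom_comul F f).comp (RightStr.IsHom.vcomp (isHom_comul F (Arrow.mk (F f).i))
    (F f).str.isHom_id)).comp (RightStr.isHom_assoc _ _ _)
  have h₂ := (isHom_comul F f).comp
    (RightStr.IsHom.vcomp (isHom_map F (comulSq F f)) (isHom_comul F f))
  refine ((F f).uniq _ h₂ h₁ ?_ ?_).trans ?_
  · exact (Category.comp_id _).symm
  · refine (i_comul_assoc F f _).trans ((i_map F (comulSq F f)).trans ?_)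
    refine (Category.id_comp _).trans (Eq.symm ?_)
    refine (congrArg (_ ≫ ·) (Category.comp_id _)).trans ?_
    exact (i_comul_assoc F f _).trans (i_comul F (Arrow.mk (F f).i))
  · exact Category.comp_id _

/-- The component of the canonical transformation from `L R` to `R L`. -/
@[reducible]
def distribSq (f : Arrow E) :
    Arrow.mk (F (Arrow.mk (F f).p)).i ⟶ Arrow.mk (F (Arrow.mk (F f).i)).p :=
  Arrow.homMk (comul F f) (mul F f) ((comul_p F f).trans (i_mul F f).symm)

lemma isHom_map_distrib_mul (f : Arrow E) :
    (F (Arrow.mk (F (Arrow.mk (F f).p)).i)).str.IsHom (F (Arrow.mk (F f).i)).str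
      (Arrow.homMk (f := Arrow.mk (F (Arrow.mk (F (Arrow.mk (F f).p)).i)).p)
        (g := Arrow.mk (F (Arrow.mk (F f).i)).p)
        (map F (distribSq F f) ≫ mul F (Arrow.mk (F f).i)) (mul F f)
        ((Category.assoc _ _ _).trans ((congrArg (map F (distribSq F f) ≫ ·)
          (mul_p F (Arrow.mk (F f).i))).trans (map_p F (distribSq F f))))) := by
  convert (isHom_map F (distribSq F f)).comp (isHom_mul F (Arrow.mk (F f).i)) using 1
  ext
  · rfl
  · exact (Category.comp_id _).symm

/-- This is the one new identity in the distributive law: it is a component of both the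
multiplication and the comultiplication axioms. The two sides are morphisms from the free right map
on `R f` to the composite of `R (L f)` and `R f`; the right-hand one is obtained by vertical
composition with the multiplication as lower square. -/
lemma mul_comul (f : Arrow E) :
    mul F f ≫ comul F f = comul F (Arrow.mk (F f).p) ≫ map F (distribSq F f) ≫
      mul F (Arrow.mk (F f).i) := by
  have h₁ := (isHom_mul F f).comp (isHom_comul F f)
  have h₂ := (isHom_comul F (Arrow.mk (F f).p)).comp
    (RightStr.IsHom.vcomp (isHom_map_distrib_mul F f) (isHom_mul F f))
  refine (F _).uniq _ h₁ h₂ rfl ?_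
  refine (i_mul_assoc F f _).trans (Eq.symm ?_)
  refine (i_comul_assoc F (Arrow.mk (F f).p) _).trans ?_
  refine (i_map_assoc F (distribSq F f) _).trans ?_
  exact (congrArg (_ ≫ ·) (i_mul F (Arrow.mk (F f).i))).trans (Category.comp_id _)

/-- The algebraic weak factorization system given by free right maps. -/
def awfs : AWFS E where
  fact := factorization F
  δ :=
    { app f := comulSq F f
      naturality f g φ := by
        ext
        · exact (Category.comp_id _).trans (Category.id_comp _).symm
        · exact map_comul F φ }
  coassoc f := by
    ext
    · rfl
    · exact comul_map_comul F f
  left_counit f := by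
    ext
    · exact Category.comp_id _
    · exact comul_p F f
  right_counit f := by
    ext
    · exact Category.comp_id _
    · exact comul_map_counit F f
  μ :=
    { app f := mulSq F f
      naturality f g φ := by
        ext
        · exact map_mul F φ
        · exact (Category.comp_id _).trans (Category.id_comp _).symm }
  assoc f := by
    ext
    · exact map_mul_mul F f
    · rfl
  left_unit f := by
    ext
    · exact i_mul F f
    · exact Category.comp_id _
  right_unit f := by
    ext
    · exact map_unit_mul F f
    · exact Category.comp_id _
  distrib_unit f := by
    ext
    · exact i_comul F f
    · exact map_unit_mul F f
  distrib_counit f := by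
    ext
    · exact comul_map_counit F f
    · exact mul_p F f
  distrib_mul f := by
    ext
    · exact mul_comul F f
    · change map F (mulSq F f) ≫ mul F f = mul F (Arrow.mk (F f).p) ≫ mul F f ≫ 𝟙 _
      rw [Category.comp_id, map_mul_mul]
  distrib_comul f := by
    ext
    · exact (comul_map_comul F f).trans (Category.id_comp _).symm
    · exact mul_comul F f

/-! ### Monad algebras are right maps -/

/-- The structure map of the monad algebra of a right map. -/
def algStr {g : Arrow E} (t : RightStr U g) : Arrow.mk (F g).p ⟶ g :=
  Arrow.homMk ((F g).desc t (𝟙 g)) (𝟙 _) ((F g).desc_w t (𝟙 g))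

lemma isHom_algStr {g : Arrow E} (t : RightStr U g) : (F g).str.IsHom t (algStr F t) :=
  (F g).isHom_desc t (𝟙 g)

lemma unit_algStr {g : Arrow E} (t : RightStr U g) : (F g).unit ≫ algStr F t = 𝟙 g := by
  ext
  · exact (F g).i_desc t (𝟙 g)
  · exact Category.comp_id _

lemma sq_uniq {f g : Arrow E} (t : RightStr U g) {φ ψ : Arrow.mk (F f).p ⟶ g}
    (hφ : (F f).str.IsHom t φ) (hψ : (F f).str.IsHom t ψ)
    (h : (F f).unit ≫ φ = (F f).unit ≫ ψ) : φ = ψ := by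
  have hr : φ.right = ψ.right :=
    (Category.id_comp _).symm.trans ((congrArg Arrow.Hom.right h).trans (Category.id_comp _))
  ext
  · exact (F f).uniq t hφ hψ hr (congrArg Arrow.Hom.left h)
  · exact hr

lemma unit_mapSq {f g : Arrow E} (φ : f ⟶ g) :
    (F f).unit ≫ mapSq F φ = φ ≫ (F g).unit := by
  ext
  · exact i_map F φ
  · exact (Category.id_comp _).trans (Category.comp_id _).symm

lemma unit_mulSq (f : Arrow E) : (F (Arrow.mk (F f).p)).unit ≫ mulSq F f = 𝟙 _ := by
  ext
  · exact i_mul F f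
  · exact Category.comp_id _

/-- Both sides are morphisms of right maps out of a free one and restrict to `φ` along the unit. -/
lemma mapSq_algStr {g h : Arrow E} {s : RightStr U g} {t : RightStr U h} {φ : g ⟶ h}
    (hφ : s.IsHom t φ) : mapSq F φ ≫ algStr F t = algStr F s ≫ φ := by
  refine sq_uniq F t ((isHom_map F φ).comp (isHom_algStr F t))
    ((isHom_algStr F s).comp hφ) ?_
  rw [← Category.assoc, unit_mapSq, Category.assoc, unit_algStr, Category.comp_id,
    ← Category.assoc, unit_algStr, Category.id_comp]

lemma mulSq_algStr {g : Arrow E} (t : RightStr U g) :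
    mulSq F g ≫ algStr F t = mapSq F (algStr F t) ≫ algStr F t := by
  refine sq_uniq F t ((isHom_mul F g).comp (isHom_algStr F t))
    ((isHom_map F _).comp (isHom_algStr F t)) ?_
  rw [← Category.assoc, unit_mulSq, Category.id_comp,
    ← Category.assoc, unit_mapSq, Category.assoc, unit_algStr, Category.comp_id]

/-- The functor from right maps to monad algebras. -/
def rightMapToAlg : RightMap U ⥤ (awfs F).RAlg where
  obj p :=
    { A := p.arrow
      a := algStr F p.str
      unit := unit_algStr F p.str
      assoc := mulSq_algStr F p.str }
  map {p q} α :=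
    { f := α.sq
      h := mapSq_algStr F (s := p.str) (t := q.str) α.comm }
  map_id _ := rfl
  map_comp _ _ := rfl

/-- The structure of right map on the underlying arrow of an algebra. -/
@[reducible]
def strOfAlg {g : Arrow E} (a : Arrow.mk (F g).p ⟶ g) (ha : (F g).unit ≫ a = 𝟙 g) :
    RightStr U g where
  lift j sq := (F g).str.lift j (sq ≫ (F g).unit) ≫ a.left
  fac_left j sq := by
    rw [← Category.assoc, (F g).str.fac_left, ← Arrow.comp_left, Category.assoc, ha,
      Category.comp_id]
  fac_right j sq := by
    rw [Category.assoc, Arrow.w a, ← Category.assoc]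
    refine (congrArg (· ≫ a.right) ((F g).str.fac_right j _)).trans ?_
    rw [← Arrow.comp_right, Category.assoc, ha, Category.comp_id]
  natural σ sq := by
    rw [← Category.assoc, (F g).str.natural, Category.assoc]

/-- The fillers on `g` are free fillers pushed along `a`. Comparing `mapSq F a` with `mulSq F g` on
a filler in the doubly free right map, associativity of the algebra says precisely that `a` respects
fillers. -/
lemma isHom_strOfAlg {g : Arrow E} (a : Arrow.mk (F g).p ⟶ g) (ha : (F g).unit ≫ a = 𝟙 g)
    (h : mulSq F g ≫ a = mapSq F a ≫ a) : (F g).str.IsHom (strOfAlg F a ha) a := by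
  intro j sq
  have h₁ := isHom_map F a j (sq ≫ (F (Arrow.mk (F g).p)).unit)
  have h₂ := isHom_mul F g j (sq ≫ (F (Arrow.mk (F g).p)).unit)
  rw [Category.assoc, unit_mulSq, Category.comp_id] at h₂
  rw [Category.assoc, unit_mapSq, ← Category.assoc] at h₁
  refine (congrArg (· ≫ a.left) h₂).symm.trans
    (Eq.trans ?_ (congrArg (· ≫ a.left) h₁))
  refine (Category.assoc _ _ _).trans (Eq.trans ?_ (Category.assoc _ _ _).symm)
  exact congrArg (_ ≫ ·) (congrArg Arrow.Hom.left h)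

/-- The functor from monad algebras to right maps. -/
def algToRightMap : (awfs F).RAlg ⥤ RightMap U where
  obj A := (strOfAlg F A.a A.unit).rightMap
  map {A B} φ :=
    { sq := φ.f
      comm j sq := by
        have h₁ := isHom_map F φ.f j (sq ≫ (F A.A).unit)
        rw [Category.assoc, unit_mapSq, ← Category.assoc] at h₁
        refine (Category.assoc _ _ _).trans (Eq.trans ?_ (congrArg (· ≫ B.a.left) h₁))
        refine Eq.trans ?_ (Category.assoc _ _ _).symm
        exact congrArg (_ ≫ ·) (congrArg Arrow.Hom.left φ.h).symm }
  map_id _ := rfl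
  map_comp _ _ := rfl

lemma algebra_ext {C : Type u} [Category.{v} C] {T : Monad C} {A B : T.Algebra}
    (hA : A.A = B.A) (ha : HEq A.a B.a) : A = B := by
  cases A; cases B; cases hA; cases ha; rfl

/-- The awfs of free right maps is algebraically free. -/
lemma awfs_isAlgebraicallyFree : (awfs F).IsAlgebraicallyFree U := by
  refine IsoOver.of_faithful (algToRightMap F) (rightMapToAlg F) rfl rfl (fun A => ?_)
    (fun p => ?_)
  · refine algebra_ext rfl (heq_of_eq ?_)
    -- The given and the reconstructed structure maps are both morphisms of right maps for the
    -- structure extracted from `A`, and both are retractions of the unit.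
    refine sq_uniq F (strOfAlg F A.a A.unit) (isHom_algStr F _)
      (isHom_strOfAlg F A.a A.unit A.assoc) ?_
    exact (unit_algStr F _).trans A.unit.symm
  · obtain ⟨g, l, h₁, h₂, h₃⟩ := p
    dsimp only [algToRightMap, rightMapToAlg, RightStr.rightMap]
    congr
    funext j sq
    refine (isHom_algStr F _ j _).trans ?_
    rw [Category.assoc, unit_algStr, Category.comp_id]

/-! ### Coalgebras are left maps -/

/-- The functor from left maps against right maps to coalgebras. -/
def leftMapToCoalg : LeftMap (RightMap.forget U) ⥤ (awfs F).LCoalg where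
  obj p :=
    { V := p.arrow
      str := Arrow.homMk (𝟙 _) (p.lift (F p.arrow).str.rightMap (F p.arrow).unit)
        ((Category.id_comp _).trans
          (p.fac_left (F p.arrow).str.rightMap (F p.arrow).unit).symm)
      counit := by
        ext
        · exact Category.comp_id _
        · exact p.fac_right (F p.arrow).str.rightMap (F p.arrow).unit }
  map {p q} α :=
    { f := α.sq
      comm := by
        ext
        · exact (Category.id_comp _).trans (Category.comp_id _).symm
        · refine (p.natural (i := (F p.arrow).str.rightMap) (j := (F q.arrow).str.rightMap)
            (isHom_map F α.sq).hom (F p.arrow).unit).trans ?_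
          refine Eq.trans ?_ (α.comm (F q.arrow).str.rightMap (F q.arrow).unit).symm
          exact congrArg (p.lift (F q.arrow).str.rightMap) (unit_mapSq F α.sq) }
  map_id _ := rfl
  map_comp _ _ := rfl

lemma unit_descSq {f g : Arrow E} (t : RightStr U g) (φ : f ⟶ g) :
    (F f).unit ≫ Arrow.homMk (f := Arrow.mk (F f).p) ((F f).desc t φ) φ.right
      ((F f).desc_w t φ) = φ := by
  ext
  · exact (F f).i_desc t φ
  · exact Category.id_comp _

lemma desc_comp {f g h : Arrow E} {t : RightStr U g} {r : RightStr U h} (φ : f ⟶ g) {ψ : g ⟶ h}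
    (hψ : t.IsHom r ψ) : (F f).desc t φ ≫ ψ.left = (F f).desc r (φ ≫ ψ) := by
  refine (F f).uniq r (((F f).isHom_desc t φ).comp hψ) ((F f).isHom_desc r (φ ≫ ψ)) rfl ?_
  exact ((F f).i_desc_assoc t φ _).trans ((F f).i_desc r (φ ≫ ψ)).symm

lemma map_desc {f g h : Arrow E} (φ : f ⟶ g) (t : RightStr U h) (ψ : g ⟶ h) :
    map F φ ≫ (F g).desc t ψ = (F f).desc t (φ ≫ ψ) := by
  refine (F f).uniq t ((isHom_map F φ).comp ((F g).isHom_desc t ψ))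
    ((F f).isHom_desc t (φ ≫ ψ)) rfl ?_
  refine (i_map_assoc F φ _).trans ((congrArg (_ ≫ ·) ((F g).i_desc t ψ)).trans ?_)
  exact ((F f).i_desc t (φ ≫ ψ)).symm

lemma desc_unit (f : Arrow E) : (F f).desc (F f).str (F f).unit = 𝟙 _ :=
  (F f).uniq (F f).str ((F f).isHom_desc _ _) (F f).str.isHom_id rfl
    (((F f).i_desc _ _).trans (Category.comp_id _).symm)

/-- The counit is an identity on domains, so a coalgebra structure carries information on codomains
only. -/
lemma coalg_str_left (c : (awfs F).LCoalg) : c.str.left = 𝟙 c.V.left :=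
  (Category.comp_id _).symm.trans (congrArg Arrow.Hom.left c.counit)

lemma coalg_str_right_p (c : (awfs F).LCoalg) : c.str.right ≫ (F c.V).p = 𝟙 c.V.right :=
  congrArg Arrow.Hom.right c.counit

lemma coalg_hom_str_right (c : (awfs F).LCoalg) : c.V.hom ≫ c.str.right = (F c.V).i :=
  (Arrow.w c.str).symm.trans
    ((congrArg (· ≫ (F c.V).i) (coalg_str_left F c)).trans (Category.id_comp _))

/-- The functor from coalgebras to left maps against right maps. -/
def coalgToLeftMap : (awfs F).LCoalg ⥤ LeftMap (RightMap.forget U) where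
  obj c :=
    { arrow := c.V
      lift q sq := c.str.right ≫ (F c.V).desc q.str sq
      fac_left q sq := (Category.assoc _ _ _).symm.trans
        ((congrArg (· ≫ (F c.V).desc q.str sq) (coalg_hom_str_right F c)).trans
          ((F c.V).i_desc q.str sq))
      fac_right q sq := by
        refine (Category.assoc _ _ _).trans
          ((congrArg (_ ≫ ·) ((F c.V).desc_w q.str sq)).trans ?_)
        refine (Category.assoc _ _ _).symm.trans
          ((congrArg (· ≫ sq.right) (coalg_str_right_p F c)).trans (Category.id_comp _))
      natural {q r} σ sq := (Category.assoc _ _ _).trans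
        (congrArg (_ ≫ ·) (desc_comp F (t := q.str) (r := r.str) sq σ.comm)) }
  map {p q} α :=
    { sq := α.f
      comm j s := by
        refine (Category.assoc _ _ _).symm.trans
          ((congrArg (· ≫ (F q.V).desc j.str s) (congrArg Arrow.Hom.right α.comm).symm).trans ?_)
        exact (Category.assoc _ _ _).trans (congrArg (_ ≫ ·) (map_desc F α.f j.str s)) }
  map_id _ := rfl
  map_comp _ _ := rfl

/-- Left maps against right maps are the coalgebras of the awfs of free right maps. -/
lemma leftMap_isoOver_coalg :
    IsoOver (LeftMap.forget (RightMap.forget U)) (awfs F).forgetLCoalg := by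
  refine IsoOver.of_faithful (leftMapToCoalg F) (coalgToLeftMap F) rfl rfl (fun p => ?_)
    (fun c => ?_)
  · obtain ⟨g, l, h₁, h₂, h₃⟩ := p
    dsimp only [coalgToLeftMap, leftMapToCoalg]
    congr
    funext q sq
    refine (h₃ (i := (F g).str.rightMap) (j := q)
      (RightStr.IsHom.hom (t := q.str) ((F g).isHom_desc q.str sq)) (F g).unit).trans ?_
    exact congrArg (l q) (unit_descSq F q.str sq)
  · obtain ⟨V, s, hs⟩ := c
    have h : ((leftMapToCoalg F).obj ((coalgToLeftMap F).obj ⟨V, s, hs⟩)).str = s := by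
      ext
      · exact (coalg_str_left F ⟨V, s, hs⟩).symm
      · exact (congrArg (s.right ≫ ·) (desc_unit F V)).trans (Category.comp_id _)
    dsimp only [coalgToLeftMap, leftMapToCoalg] at h ⊢
    congr

end FreeRightMap

end

/-! ### Normalizing a universal right map to a fixed codomain -/

section Universal

variable {E : Type u} [Category.{v} E] {J : Type u₁} [Category.{v₁} J]

/-- The unique structure of right map on an identity. -/
def RightStr.ofId (U : J ⥤ Arrow E) (Y : E) : RightStr U (Arrow.mk (𝟙 Y)) where
  lift _ sq := sq.right
  fac_left _ sq := (Arrow.w sq).symm.trans (Category.comp_id _)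
  fac_right _ _ := Category.comp_id _
  natural _ _ := rfl

/-- Fillers against an identity are forced to be the bottom side of the square, so nothing needs to
be respected. -/
lemma RightStr.isHom_ofId {U : J ⥤ Arrow E} {g : Arrow E} (s : RightStr U g) {Y : E}
    (φ : g ⟶ Arrow.mk (𝟙 Y)) : s.IsHom (RightStr.ofId U Y) φ := by
  intro j sq
  have h := Arrow.w φ
  have h' := s.fac_right j sq
  refine (congrArg (_ ≫ ·) ((Category.comp_id _).symm.trans h)).trans ?_
  exact (Category.assoc _ _ _).symm.trans (congrArg (· ≫ φ.right) h')

/-- A universal arrow to right maps can be replaced by one which is the identity on codomains. -/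
lemma FreeRightMap.nonempty_of_universal {U : J ⥤ Arrow E} {f : Arrow E} (R : RightMap U)
    (η : f ⟶ R.arrow)
    (hη : ∀ (q : RightMap U) (s : f ⟶ q.arrow), ∃! φ : R ⟶ q, η ≫ φ.sq = s) :
    Nonempty (FreeRightMap U f) := by
  obtain ⟨φ, hφ, -⟩ := hη (RightStr.ofId U f.right).rightMap
    (Arrow.homMk f.hom (𝟙 _) rfl)
  have h₁ : η.right ≫ φ.sq.right = 𝟙 f.right := congrArg Arrow.Hom.right hφ
  -- Two morphisms from `R` to the identity on its own codomain agree after `η`, hence are equal;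
  -- their bottom sides give the equation. Together with `h₁` this makes `η.right` invertible.
  have h₂ : φ.sq.right ≫ η.right = 𝟙 R.arrow.right := by
    let k : Arrow.mk (𝟙 f.right) ⟶ Arrow.mk (𝟙 R.arrow.right) :=
      Arrow.homMk η.right η.right
        ((Category.comp_id η.right).trans (Category.id_comp η.right).symm)
    let t : R.arrow ⟶ Arrow.mk (𝟙 R.arrow.right) := Arrow.homMk R.arrow.hom (𝟙 _) rfl
    have := (hη (RightStr.ofId U R.arrow.right).rightMap (η ≫ t)).unique
      (y₁ := (RightStr.isHom_ofId R.str (φ.sq ≫ k)).hom)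
      (y₂ := (RightStr.isHom_ofId R.str t).hom)
      (by
        change η ≫ φ.sq ≫ k = η ≫ t
        rw [← Category.assoc, hφ]
        ext
        · exact (Arrow.w η).symm
        · exact (Category.id_comp _).trans (Category.comp_id _).symm) rfl
    exact congrArg (fun α => α.sq.right) this
  -- The codomain of `R` is replaced by that of `f` along this isomorphism, and the right map
  -- structure is transported with it.
  let k : Arrow.mk (R.arrow.hom ≫ φ.sq.right) ⟶ R.arrow :=
    Arrow.homMk (𝟙 _) η.right (by simp [h₂])
  let k' : R.arrow ⟶ Arrow.mk (R.arrow.hom ≫ φ.sq.right) :=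
    Arrow.homMk (𝟙 _) φ.sq.right (by simp)
  have hk : k ≫ k' = 𝟙 _ := by
    ext
    · exact Category.comp_id _
    · exact h₁
  have hk' : k' ≫ k = 𝟙 _ := by
    ext
    · exact Category.comp_id _
    · exact h₂
  let str : RightStr U (Arrow.mk (R.arrow.hom ≫ φ.sq.right)) :=
    { lift j sq := R.lift j (sq ≫ k)
      fac_left j sq := (R.fac_left j _).trans (Category.comp_id _)
      fac_right j sq := by
        refine (Category.assoc _ _ _).symm.trans
          ((congrArg (· ≫ φ.sq.right) (R.fac_right j (sq ≫ k))).trans ?_)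
        exact (Category.assoc _ _ _).trans ((congrArg (_ ≫ ·) h₁).trans (Category.comp_id _))
      natural σ sq := (R.natural σ _).trans
        (congrArg (R.lift _) (Category.assoc _ _ _).symm) }
  have isHom_k : str.IsHom R.str k := fun j sq => Category.comp_id _
  have isHom_k' : R.str.IsHom str k' := by
    intro j sq
    refine (Category.comp_id _).trans (congrArg (R.lift j) ?_)
    rw [Category.assoc, hk', Category.comp_id]
  choose d hd hd' using hη
  have hr {g : Arrow E} (t : RightStr U g) (s : f ⟶ g) :
      η.right ≫ (d t.rightMap s).sq.right = s.right :=
    congrArg Arrow.Hom.right (hd t.rightMap s)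
  exact ⟨{
    Z := R.arrow.left
    i := η.left
    p := R.arrow.hom ≫ φ.sq.right
    fac := by
      refine (Category.assoc _ _ _).symm.trans ((congrArg (· ≫ φ.sq.right) (Arrow.w η)).trans ?_)
      exact (Category.assoc _ _ _).trans ((congrArg (_ ≫ ·) h₁).trans (Category.comp_id _))
    str := str
    desc t s := (d t.rightMap s).sq.left
    desc_w t s := by
      refine (Arrow.w (d t.rightMap s).sq).trans ?_
      rw [← hr t s, Category.assoc, reassoc_of% h₂]
    i_desc t s := congrArg Arrow.Hom.left (hd t.rightMap s)
    isHom_desc t s := by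
      convert isHom_k.comp (r := t) (ψ := (d t.rightMap s).sq) (d t.rightMap s).comm using 1
      ext
      · exact (Category.id_comp _).symm
      · exact (hr t s).symm
    uniq {g} t α β hα hβ hr hl := by
      have := (hd' t.rightMap (η ≫ k' ≫ α) (isHom_k'.comp hα).hom rfl).trans
        (hd' t.rightMap (η ≫ k' ≫ α) (isHom_k'.comp hβ).hom (by
          ext
          · refine (congrArg (η.left ≫ ·) (Category.id_comp _)).trans (hl.symm.trans ?_)
            exact (congrArg (η.left ≫ ·) (Category.id_comp _)).symm
          · exact congrArg (fun x => η.right ≫ φ.sq.right ≫ x) hr.symm)).symm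
      have h := congrArg (fun α => α.sq.left) this
      exact (Category.id_comp _).symm.trans (h.trans (Category.id_comp _)) }⟩

end Universal

/-! ### Presentable objects of the arrow category -/

section Presentable

variable {E : Type u} [Category.{v} E]

/-- An arrow between presentable objects is presentable. -/
lemma isCardinalPresentable_arrow [HasColimitsOfSize.{w, w} E] (κ : Cardinal.{w})
    [Fact κ.IsRegular] (g : Arrow E) [IsCardinalPresentable g.left κ]
    [IsCardinalPresentable g.right κ] : IsCardinalPresentable g κ where
  preservesColimitOfShape K _ _ :=
    { preservesColimit {D} :=
        { preserves {c} hc := ⟨by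
            have := isFiltered_of_isCardinalFiltered K κ
            have hl := isColimitOfPreserves Arrow.leftFunc hc
            have hr := isColimitOfPreserves Arrow.rightFunc hc
            apply Types.FilteredColimit.isColimitOf'
            · intro φ
              obtain ⟨k₁, l, hl'⟩ := IsCardinalPresentable.exists_hom_of_isColimit κ hl
                (Arrow.Hom.left φ)
              obtain ⟨k₂, r, hr'⟩ := IsCardinalPresentable.exists_hom_of_isColimit κ hr
                (Arrow.Hom.right φ)
              -- The two components lift to stages `k₁` and `k₂` separately and need not form a
              -- square there. The two composites agree in the colimit, hence already at some later
              -- stage `k`.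
              obtain ⟨k, a, b, hab⟩ := IsCardinalPresentable.exists_eq_of_isColimit κ hr
                (l ≫ (D.obj k₁).hom) (g.hom ≫ r) (by
                  refine (Category.assoc _ _ _).trans
                    ((congrArg (l ≫ ·) (Arrow.w (c.ι.app k₁)).symm).trans ?_)
                  refine (Category.assoc _ _ _).symm.trans
                    ((congrArg (· ≫ c.pt.hom) hl').trans ((Arrow.w φ).trans ?_))
                  exact (congrArg (g.hom ≫ ·) hr').symm.trans (Category.assoc _ _ _).symm)
              refine ⟨k, Arrow.homMk (l ≫ (D.map a).left) (r ≫ (D.map b).right) ?_, ?_⟩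
              · refine (Category.assoc _ _ _).trans
                  ((congrArg (l ≫ ·) (Arrow.w (D.map a))).trans ?_)
                exact (Category.assoc _ _ _).symm.trans (hab.trans (Category.assoc _ _ _))
              · apply Arrow.hom_ext
                · refine hl'.symm.trans (Eq.trans ?_ (Category.assoc _ _ _).symm)
                  exact congrArg (l ≫ ·) (congrArg Arrow.Hom.left (c.w a)).symm
                · refine hr'.symm.trans (Eq.trans ?_ (Category.assoc _ _ _).symm)
                  exact congrArg (r ≫ ·) (congrArg Arrow.Hom.right (c.w b)).symm
            · intro k φ ψ h
              obtain ⟨k₁, a, ha⟩ := IsCardinalPresentable.exists_eq_of_isColimit' κ hl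
                (Arrow.Hom.left φ) (Arrow.Hom.left ψ) (congrArg Arrow.Hom.left h)
              obtain ⟨k₂, b, hb⟩ := IsCardinalPresentable.exists_eq_of_isColimit' κ hr
                (Arrow.Hom.right φ) (Arrow.Hom.right ψ) (congrArg Arrow.Hom.right h)
              -- Domain and codomain components become equal along different maps, which are merged
              -- into one map out of `k`.
              obtain ⟨k', a', b', hab⟩ := IsFiltered.span a b
              refine ⟨k', a ≫ a', ?_⟩
              change φ ≫ D.map (a ≫ a') = ψ ≫ D.map (a ≫ a')
              apply Arrow.hom_ext
              · replace ha : Arrow.Hom.left φ ≫ (D.map a).left =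
                  Arrow.Hom.left ψ ≫ (D.map a).left := ha
                simp [reassoc_of% ha]
              · replace hb : Arrow.Hom.right φ ≫ (D.map b).right =
                  Arrow.Hom.right ψ ≫ (D.map b).right := hb
                simp [hab, reassoc_of% hb]⟩ } }

end Presentable

/-! ### Partial right maps and the existence of free right maps -/

section

open Opposite

variable {E : Type u} [Category.{w} E] {J : Type w} [SmallCategory J]

/-- The presheaf on `J` of all maps from codomains of arrows in `J` to the domain of an arrow. -/
def fillers (U : J ⥤ Arrow E) : Arrow E ⥤ Jᵒᵖ ⥤ Type w where
  obj f := (U ⋙ Arrow.rightFunc).op ⋙ yoneda.obj f.left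
  map φ := Functor.whiskerLeft _ (yoneda.map φ.left)

/-- An arrow with a presheaf of chosen maps from codomains of arrows in `J` to its domain. Such a
map determines a square, together with a filler of it. -/
abbrev PartialRightMap (U : J ⥤ Arrow E) := Comma (𝟭 (Jᵒᵖ ⥤ Type w)) (fillers U)

namespace PartialRightMap

variable {U : J ⥤ Arrow E}

/-- The map encoded by an element of the presheaf. -/
def filler (d : PartialRightMap U) {j : J} (x : d.left.obj (op j)) :
    (U.obj j).right ⟶ d.right.left :=
  d.hom.app (op j) x

lemma filler_naturality (d : PartialRightMap U) {i j : J} (σ : i ⟶ j) (x : d.left.obj (op j)) :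
    d.filler (d.left.map σ.op x) = (U.map σ).right ≫ d.filler x :=
  ConcreteCategory.congr_hom (d.hom.naturality σ.op) x

lemma filler_map {d e : PartialRightMap U} (φ : d ⟶ e) {j : J} (x : d.left.obj (op j)) :
    e.filler (φ.left.app (op j) x) = d.filler x ≫ φ.right.left :=
  ConcreteCategory.congr_hom (congr_app φ.w (op j)) x

/-- The square encoded by an element of the presheaf. -/
def square (d : PartialRightMap U) {j : J} (x : d.left.obj (op j)) : U.obj j ⟶ d.right :=
  Arrow.homMk ((U.obj j).hom ≫ d.filler x) (d.filler x ≫ d.right.hom) (by simp)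

lemma square_naturality (d : PartialRightMap U) {i j : J} (σ : i ⟶ j) (x : d.left.obj (op j)) :
    d.square (d.left.map σ.op x) = U.map σ ≫ d.square x := by
  have h := d.filler_naturality σ x
  ext
  · refine (congrArg ((U.obj i).hom ≫ ·) h).trans ?_
    refine (Category.assoc _ _ _).symm.trans
      ((congrArg (· ≫ d.filler x) (Arrow.w (U.map σ)).symm).trans (Category.assoc _ _ _))
  · exact (congrArg (· ≫ d.right.hom) h).trans (Category.assoc _ _ _)

/-- Every square to the arrow is encoded by a unique element of the presheaf. -/
def IsTotal (d : PartialRightMap U) : Prop :=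
  ∀ (j : J) (sq : U.obj j ⟶ d.right), ∃! x : d.left.obj (op j), d.square x = sq

/-- The right map given by a total partial right map. -/
noncomputable def IsTotal.rightStr {d : PartialRightMap U} (hd : d.IsTotal) :
    RightStr U d.right where
  lift j sq := d.filler (hd j sq).choose
  fac_left j sq := congrArg Arrow.Hom.left (hd j sq).choose_spec.1
  fac_right j sq := congrArg Arrow.Hom.right (hd j sq).choose_spec.1
  natural {i j} σ sq := by
    rw [← filler_naturality]
    congr 1
    refine (hd i (U.map σ ≫ sq)).unique ?_ (hd i _).choose_spec.1
    exact (d.square_naturality σ _).trans (congrArg (U.map σ ≫ ·) (hd j sq).choose_spec.1)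

lemma IsTotal.lift_square {d : PartialRightMap U} (hd : d.IsTotal) {j : J}
    (x : d.left.obj (op j)) : hd.rightStr.lift j (d.square x) = d.filler x :=
  congrArg d.filler ((hd j (d.square x)).unique (hd j _).choose_spec.1 rfl)

lemma square_map {d e : PartialRightMap U} (φ : d ⟶ e) {j : J} (x : d.left.obj (op j)) :
    e.square (φ.left.app (op j) x) = d.square x ≫ φ.right := by
  have h := filler_map φ x
  ext
  · refine (congrArg ((U.obj j).hom ≫ ·) h).trans (Category.assoc _ _ _).symm
  · refine (congrArg (· ≫ e.right.hom) h).trans ?_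
    refine (Category.assoc _ _ _).trans ((congrArg (d.filler x ≫ ·) (Arrow.w φ.right)).trans ?_)
    exact (Category.assoc _ _ _).symm

/-- A right map as a partial right map. -/
def ofRightMap (q : RightMap U) : PartialRightMap U where
  left := U.op ⋙ yoneda.obj q.arrow
  right := q.arrow
  hom :=
    { app j := TypeCat.ofHom fun sq => q.lift j.unop sq
      naturality i j σ := by
        ext sq
        exact (q.natural σ.unop sq).symm }

lemma square_ofRightMap (q : RightMap U) {j : J} (sq : U.obj j ⟶ q.arrow) :
    (ofRightMap q).square (j := j) sq = sq := by
  ext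
  · exact q.fac_left j sq
  · exact q.fac_right j sq

lemma isTotal_ofRightMap (q : RightMap U) : (ofRightMap q).IsTotal := fun _ sq =>
  ⟨sq, square_ofRightMap q sq, fun x hx => (square_ofRightMap q x).symm.trans hx⟩

/-- A morphism of right maps extends to a morphism of partial right maps. -/
noncomputable def IsTotal.homOfRightMap {d : PartialRightMap U} (hd : d.IsTotal) (q : RightMap U)
    (φ : hd.rightStr.rightMap ⟶ q) : d ⟶ ofRightMap q where
  left :=
    { app j := TypeCat.ofHom fun x => d.square (j := j.unop) x ≫ φ.sq
      naturality i j σ := by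
        ext x
        change d.square (d.left.map σ x) ≫ φ.sq = U.map σ.unop ≫ d.square x ≫ φ.sq
        rw [← Category.assoc]
        congr 1
        exact d.square_naturality σ.unop x }
  right := φ.sq
  w := by
    ext j x
    refine (φ.comm j.unop (d.square x)).symm.trans ?_
    exact congrArg (· ≫ φ.sq.left) (hd.lift_square x)

/-- By totality every square to `d.right` is encoded by an element, and morphisms of partial right
maps preserve both the square and the filler of an element. -/
lemma IsTotal.isHom_right {d : PartialRightMap U} (hd : d.IsTotal) (q : RightMap U)
    (φ : d ⟶ ofRightMap q) : hd.rightStr.IsHom q.str φ.right := by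
  intro j sq
  obtain ⟨x, rfl, -⟩ := hd j sq
  rw [hd.lift_square]
  refine (filler_map φ x).symm.trans (congrArg (q.lift j) ?_)
  exact (square_ofRightMap q _).symm.trans (square_map φ x)

/-! ### Total partial right maps as local objects -/

/-- The partial right map on an arrow, with no chosen maps. -/
noncomputable def free (f : Arrow E) : PartialRightMap U where
  left := ⊥_ _
  right := f
  hom := initial.to _

/-- The partial right map that represents the elements over `j`. -/
def elem (U : J ⥤ Arrow E) (j : J) : PartialRightMap U where
  left := yoneda.obj j
  right := Arrow.mk (𝟙 (U.obj j).right)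
  hom :=
    { app i := TypeCat.ofHom fun σ => (U.map σ).right
      naturality i k σ := by
        ext τ
        exact (congrArg Arrow.Hom.right (U.map_comp σ.unop τ)) }

/-- Maps from the partial right map on an arrow with no chosen maps. -/
noncomputable def freeEquiv (f : Arrow E) (d : PartialRightMap U) :
    (free f ⟶ d) ≃ (f ⟶ d.right) where
  toFun φ := φ.right
  invFun s :=
    { left := initial.to _
      right := s
      w := initial.hom_ext _ _ }
  left_inv φ := by
    ext1
    · exact initial.hom_ext _ _
    · rfl
  right_inv _ := rfl

/-- The universal element `𝟙 j` has the identity as its filler, so the presheaf component of `φ`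
already determines its arrow component. -/
lemma elem_right_left (j : J) (d : PartialRightMap U) (φ : elem U j ⟶ d) :
    φ.right.left = d.filler (j := j) (yonedaEquiv φ.left) := by
  refine Eq.trans ?_ (filler_map φ (j := j) (𝟙 j)).symm
  refine (Category.id_comp _).symm.trans (congrArg (· ≫ φ.right.left) ?_)
  exact (congrArg Arrow.Hom.right (U.map_id j)).symm

/-- Maps from the partial right map that represents the elements over `j`. -/
def elemEquiv (j : J) (d : PartialRightMap U) : (elem U j ⟶ d) ≃ d.left.obj (op j) where
  toFun φ := yonedaEquiv (X := j) φ.left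
  invFun x :=
    { left := yonedaEquiv.symm x
      right := Arrow.homMk (f := Arrow.mk (𝟙 (U.obj j).right)) (d.filler x)
        (d.filler x ≫ d.right.hom) (Category.id_comp _).symm
      w := by
        ext i σ
        exact d.filler_naturality σ x }
  left_inv φ := by
    ext1
    · exact Equiv.symm_apply_apply _ _
    · have h := elem_right_left j d φ
      ext
      · exact h.symm
      · refine (congrArg (· ≫ d.right.hom) h.symm).trans ((Arrow.w φ.right).trans ?_)
        exact Category.id_comp _
  right_inv _ := Equiv.apply_symm_apply _ _

/-- The generating morphism whose local objects have unique elements over each square. -/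
noncomputable def gen (U : J ⥤ Arrow E) (j : J) : free (U := U) (U.obj j) ⟶ elem U j :=
  (freeEquiv (U.obj j) (elem U j)).symm
    (Arrow.homMk (g := Arrow.mk (𝟙 (U.obj j).right)) (U.obj j).hom (𝟙 _) rfl)

lemma freeEquiv_gen (j : J) (d : PartialRightMap U) (φ : elem U j ⟶ d) :
    freeEquiv _ _ (gen U j ≫ φ) = d.square (elemEquiv j d φ) := by
  have h := elem_right_left j d φ
  ext
  · exact congrArg ((U.obj j).hom ≫ ·) h
  · refine (Category.id_comp _).trans (Eq.trans ?_ (congrArg (· ≫ d.right.hom) h))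
    exact (Category.id_comp _).symm.trans (Arrow.w φ.right).symm

/-- `free (U.obj j)` represents squares and `elem U j` represents elements; under these
identifications precomposition with `gen U j` is the map that sends an element to the square it
encodes. -/
lemma bijective_gen_iff (j : J) (d : PartialRightMap U) :
    Function.Bijective (fun φ : elem U j ⟶ d => gen U j ≫ φ) ↔
      ∀ sq : U.obj j ⟶ d.right, ∃! x : d.left.obj (op j), d.square x = sq := by
  rw [← Function.bijective_iff_existsUnique]
  have : (fun φ : elem U j ⟶ d => gen U j ≫ φ) =
      (freeEquiv (U.obj j) d).symm ∘ d.square ∘ elemEquiv j d := by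
    funext φ
    exact ((freeEquiv (U.obj j) d).symm_apply_eq.2 (freeEquiv_gen j d φ).symm).symm
  rw [this, Equiv.comp_bijective, Equiv.bijective_comp]

lemma isLocal_iff_isTotal (d : PartialRightMap U) :
    (MorphismProperty.ofHoms (gen U)).isLocal d ↔ d.IsTotal := by
  constructor
  · intro h j
    exact (bijective_gen_iff j d).1 (h (gen U j) ⟨j⟩)
  · rintro h _ _ _ ⟨j⟩
    exact (bijective_gen_iff j d).2 (h j)

/-! ### The reflection -/

/-- Maps out of `elem U j` are computed by projecting to presheaves and evaluating at `j`, and both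
functors preserve colimits. Hence any regular `κ` works. -/
lemma isCardinalPresentable_elem (κ : Cardinal.{w}) [Fact κ.IsRegular]
    [HasColimitsOfSize.{w, w} E] (j : J) : IsCardinalPresentable (elem U j) κ := by
  let e : coyoneda.obj (op (elem U j)) ≅
      Comma.fst (𝟭 (Jᵒᵖ ⥤ Type w)) (fillers U) ⋙ (evaluation _ _).obj (op j) :=
    NatIso.ofComponents (fun d => (elemEquiv j d).toIso) (fun φ => by
      ext ψ
      rfl)
  have : PreservesColimitsOfSize.{w, w} (Comma.fst (𝟭 (Jᵒᵖ ⥤ Type w)) (fillers U)) :=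
    ⟨inferInstance⟩
  exact Functor.isCardinalAccessible_of_natIso e.symm κ

/-- Maps out of `free f` are maps out of `f` after a colimit-preserving projection, so
presentability is inherited from `f`. -/
lemma isCardinalPresentable_free (κ : Cardinal.{w}) [Fact κ.IsRegular]
    [HasColimitsOfSize.{w, w} E] (f : Arrow E) [IsCardinalPresentable f κ] :
    IsCardinalPresentable (free (U := U) f) κ := by
  let e : coyoneda.obj (op (free (U := U) f)) ≅
      Comma.snd (𝟭 (Jᵒᵖ ⥤ Type w)) (fillers U) ⋙ coyoneda.obj (op f) :=
    NatIso.ofComponents (fun d => (freeEquiv f d).toIso) (fun φ => by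
      ext ψ
      rfl)
  have : PreservesColimitsOfSize.{w, w} (Comma.snd (𝟭 (Jᵒᵖ ⥤ Type w)) (fillers U)) :=
    ⟨inferInstance⟩
  exact Functor.isCardinalAccessible_of_natIso e.symm κ

end PartialRightMap

open PartialRightMap

/-- A small family of objects of a locally presentable category is uniformly presentable. -/
lemma exists_isCardinalPresentable [IsLocallyPresentable.{w} E] {ι : Type w} (X : ι → E) :
    ∃ (κ : Cardinal.{w}) (_ : Fact κ.IsRegular), ∀ i, IsCardinalPresentable (X i) κ := by
  choose c hc hX using fun i => (inferInstance : IsPresentable.{w} (X i)).exists_cardinal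
  -- A regular cardinal above all the `c i`: presentability persists when the cardinal is raised.
  obtain ⟨κ, hκ, h⟩ := HasCardinalLT.exists_regular_cardinal_forall.{w}
    (fun i => (c i).ord.ToType)
  refine ⟨κ, ⟨hκ⟩, fun i => ?_⟩
  have := hc i
  have := hX i
  have : Fact κ.IsRegular := ⟨hκ⟩
  exact isCardinalPresentable_of_le (κ := c i) (X i)
    (le_of_lt (by simpa [hasCardinalLT_iff_cardinal_mk_lt] using h i))

/-- Free right maps exist in a locally presentable category. -/
lemma nonempty_freeRightMap [IsLocallyPresentable.{w} E] (U : J ⥤ Arrow E) (f : Arrow E) :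
    Nonempty (FreeRightMap U f) := by
  obtain ⟨κ, _, hκ⟩ := exists_isCardinalPresentable
    (Sum.elim (fun j => (U.obj j).left) (fun j => (U.obj j).right))
  -- Orthogonality to a small family of maps with presentable sources and targets defines a
  -- reflective subcategory. The reflection of `free f` is total and is the universal right map
  -- under `f`.
  have := MorphismProperty.isRightAdjoint_ι_isLocal (MorphismProperty.ofHoms (gen U)) κ (by
    rintro _ _ _ ⟨j⟩
    have : IsCardinalPresentable (U.obj j).left κ := hκ (Sum.inl j)
    have : IsCardinalPresentable (U.obj j).right κ := hκ (Sum.inr j)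
    have := isCardinalPresentable_arrow κ (U.obj j)
    exact ⟨isCardinalPresentable_free κ _, isCardinalPresentable_elem κ j⟩)
  let W := MorphismProperty.ofHoms (gen U)
  let adj := Adjunction.ofIsRightAdjoint W.isLocal.ι
  let d := (W.isLocal.ι.leftAdjoint).obj (free f)
  have hd := (isLocal_iff_isTotal d.obj).1 d.property
  let η : free f ⟶ d.obj := adj.unit.app (free f)
  refine FreeRightMap.nonempty_of_universal hd.rightStr.rightMap η.right (fun q s => ?_)
  let e : W.isLocal.FullSubcategory :=
    ⟨ofRightMap q, (isLocal_iff_isTotal _).2 (isTotal_ofRightMap q)⟩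
  let φ : d ⟶ e := (adj.homEquiv _ _).symm ((freeEquiv f (ofRightMap q)).symm s)
  have hφ : η ≫ φ.hom = (freeEquiv f (ofRightMap q)).symm s :=
    (adj.homEquiv_unit _ _ φ).symm.trans (Equiv.apply_symm_apply _ _)
  refine ⟨(hd.isHom_right q φ.hom).hom, congrArg CommaMorphism.right hφ, fun α hα => ?_⟩
  -- For uniqueness, a competing morphism of right maps is extended to partial right maps; it then
  -- has the same adjoint transpose as `φ`, namely the square `s`.
  have h : φ = ObjectProperty.homMk (hd.homOfRightMap q α) := by
    apply (adj.homEquiv _ _).injective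
    refine (Equiv.apply_symm_apply _ _).trans (Eq.trans ?_ (adj.homEquiv_unit _ _ _).symm)
    exact (Equiv.symm_apply_eq _).2 hα.symm
  exact RightMap.Hom.ext (congrArg (fun χ => χ.hom.right) h).symm

end

end UniformFibrations

theorem mainTheorem5 {E : Type u} [Category.{w} E] [IsLocallyPresentable.{w} E]
    [UniformFibrations.LocallyCartesianClosed E]
    (T : UniformFibrations.Cylinder E) (hT : T.I.IsLeftAdjoint)
    (A : UniformFibrations.AWFS E) (hA : A.IsSuitable T)
    {J : Type w} [SmallCategory J] (U : J ⥤ Arrow E) (hU : A.IsAlgebraicallyFree U) :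
    ∃ B : UniformFibrations.AWFS E,
      UniformFibrations.AWFS.IsCofibrantlyGenerated.{w} B ∧
      UniformFibrations.IsoOver (T.forgetTrivCof U) B.forgetLCoalg ∧
      UniformFibrations.IsoOver (T.forgetFib U) B.forgetRAlg := by
  have F : ∀ f : Arrow E, UniformFibrations.FreeRightMap (T.tensor U) f := fun f =>
    (UniformFibrations.nonempty_freeRightMap (T.tensor U) f).some
  have hF := UniformFibrations.FreeRightMap.awfs_isAlgebraicallyFree F
  exact ⟨UniformFibrations.FreeRightMap.awfs F, ⟨J ⊕ J, inferInstance, T.tensor U, hF⟩,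
    UniformFibrations.FreeRightMap.leftMap_isoOver_coalg F, hF.symm⟩
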